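/- **Programs and arguments.** An objective literal is an atom $A$ or its explicit negation $\neg A$ (with $\neg\neg L=L$). An extended logic program $P$ is a possibly infinite set of rules $L_0\leftarrow L_1,\dots,L_m,\mathit{not}\,L_{m+1},\dots,\mathit{not}\,L_{m+n}$ ($m,n\ge 0$) with objective literals $L_i$. An argument of $P$ is a finite sequence $[r_1,\dots,r_k]$ of ground instances of rules of $P$ such that each objective literal in the body of $r_i$ is the head of some $r_j$ with $j>i$. The heads of its rules are its conclusions, the default literals $\mathit{not}\,L$ in their bodies are its assumptions. An argument is minimal if, for some conclusion $L$ of it, no other subsequence of it is an argument with conclusion $L$. Below, "argument" means minimal argument, and an argument for $L$ is one with conclusion $L$. **Attacks.** $A$ undercuts $B$ ($\mathsf u$) if some conclusion $L$ of $A$ has $\mathit{not}\,L$ among the assumptions of $B$. $A$ rebuts $B$ ($\mathsf r$) if some conclusion $L$ of $A$ has $\neg L$ among the conclusions of $B$. Put $\mathsf a=\mathsf u\cup\mathsf r$ (attack), $\mathsf d=\mathsf u\cup(\mathsf r-\mathsf u^{-1})$ (defeat), $\mathsf{sa}=\mathsf a-\mathsf u^{-1}$ and $\mathsf{su}=\mathsf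 u-\mathsf u^{-1}$. In the following $x,y,x',y'\in\{\mathsf a,\mathsf u,\mathsf d,\mathsf{sa},\mathsf{su}\}$. $J_{P,x/y}$ is the least fixpoint of $S\mapsto\{A:\text{each }B\text{ that }x\text{-attacks }A\text{ is }y\text{-attacked by some }C\in S\}$ on sets of arguments of $P$. For such semantics, $J=J'$ means equality for all programs, and $J\subsetneq J'$ means inclusion for all programs and inequality for some program. **Known semantics.** $J_{Dung}$ is Dung's grounded semantics: the least fixpoint in which every argument that attacks (undercuts or rebuts) an accepted argument must be undercut by an accepted argument. $J_{PS}$ is Prakken and Sartor's semantics without priorities and strict rules: the least fixpoint in which every argument that defeats an accepted argument must be strictly defeated by an accepted one, a strict defeat being a defeat that is not counter-defeated. $J_{WFS}$ is the well-founded argumentation semantics for normal programs (attack and defence by undercuts), applied to $P$ with explicitly negated atoms read as new, unrelated atoms, and $WFS(P)=T\cup\mathit{not}\,F$ is the well-founded model (defined by unfounded sets) of the ground instances of $P$ read in this way. For a set $I$ of ground objective literals, $\Gamma I$ is the least model of the definite program obtained from the ground instances of $P$ by deleting the rules having some $\mathit{not}\,L$ with $L\in I$ in the body, and deleting all other default literals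 (objective literals being treated as atoms); $\Gamma_s$ is the same for the semi-normal program, in which each rule $L\leftarrow Body$ is replaced by $L\leftarrow\mathit{not}\,\neg L,Body$. If $T$ is the least fixpoint of $\Gamma\Gamma_s$ and $\mathcal H$ the set of ground objective literals, then $WFSX_p(P)=T\cup\mathit{not}\,(\mathcal H-\Gamma_sT)$. **Statement.** 1. The semantics $J_{x/y}$ fall into exactly ten classes: $\mathsf a/y$ (all $y$); $\mathsf d/y$ (all $y$); $\mathsf{sa}/\mathsf{su}=\mathsf{sa}/\mathsf{sa}$; $\mathsf u/\mathsf{su}=\mathsf u/\mathsf u$; $\mathsf{sa}/\mathsf u=\mathsf{sa}/\mathsf d=\mathsf{sa}/\mathsf a$; $\mathsf{su}/\mathsf{su}$; $\mathsf u/\mathsf a=\mathsf u/\mathsf d=\mathsf u/\mathsf{sa}$; $\mathsf{su}/\mathsf u$; $\mathsf{su}/\mathsf{sa}$; $\mathsf{su}/\mathsf a=\mathsf{su}/\mathsf d$. Thus $J_{x/y}=J_{x'/y'}$ if and only if $x/y$ and $x'/y'$ are in the same class. 2. $J_{x/y}\subsetneq J_{x'/y'}$ if and only if the class of $x/y$ lies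 below that of $x'/y'$ in the strict order generated by the arcs $\mathsf a/y<\mathsf d/y$; $\mathsf d/y<\mathsf{sa}/\mathsf{su}$; $\mathsf d/y<\mathsf u/\mathsf u$; $\mathsf{sa}/\mathsf{su}<\mathsf{sa}/\mathsf u$; $\mathsf{sa}/\mathsf{su}<\mathsf{su}/\mathsf{su}$; $\mathsf u/\mathsf u<\mathsf{su}/\mathsf{su}$; $\mathsf u/\mathsf u<\mathsf u/\mathsf a$; $\mathsf{sa}/\mathsf u<\mathsf{su}/\mathsf u$; $\mathsf{su}/\mathsf{su}<\mathsf{su}/\mathsf u$; $\mathsf{su}/\mathsf{su}<\mathsf{su}/\mathsf{sa}$; $\mathsf u/\mathsf a<\mathsf{su}/\mathsf{sa}$; $\mathsf{su}/\mathsf u<\mathsf{su}/\mathsf a$; $\mathsf{su}/\mathsf{sa}<\mathsf{su}/\mathsf a$. 3. The known semantics stand in this hierarchy as follows. - $J_{Dung}=J_{\mathsf a/y}$ and $J_{PS}=J_{\mathsf d/y}$ for all $y$. - $J_{WFS}=J_{\mathsf u/\mathsf u}=J_{\mathsf u/\mathsf{su}}$. Moreover, for every program $P$, $WFS(P)$ consists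 of the conclusions of arguments in $J_{P,\mathsf u/\mathsf u}$ and of the $\mathit{not}\,L$ such that each argument for $L$ is undercut by an argument in $J_{P,\mathsf u/\mathsf u}$. - For every program $P$ and $y\in\{\mathsf a,\mathsf d,\mathsf{sa}\}$, $WFSX_p(P)$ consists of the conclusions of arguments in $J_{P,\mathsf u/y}$ and of the $\mathit{not}\,L$ such that each argument for $L$ is attacked by an argument in $J_{P,\mathsf u/y}$. 4. In particular $J_{Dung}\subsetneq J_{PS}\subsetneq J_{WFS}\subsetneq J_{\mathsf u/\mathsf a}$. Also $WFS\subsetneq WFSX_p$ as models: $WFS(P)\subseteq WFSX_p(P)$ for every program $P$, and the two differ for some $P$. -/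

import Mathlib

universe u v w

noncomputable section

namespace ELP

/-! ## Literals, rules, arguments

`β` is the type of ground objective literals (or, for a normal program, of ground atoms). -/

/-- A rule `head ← pos₁, …, posₘ, not naf₁, …, not nafₙ`. -/
structure Rule (β : Type w) where
  head : β
  pos : List β
  naf : List β

/-- Applies a function to all the objective literals of a rule. -/
def Rule.map {β : Type u} {γ : Type v} (f : β → γ) (r : Rule β) : Rule γ :=
  ⟨f r.head, r.pos.map f, r.naf.map f⟩

/-- Objective literals over a type of atoms: an atom or its explicit negation. -/
inductive ObjLit (α : Type w)
  | pos (a : α)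
  | neg (a : α)

/-- Explicit negation, with `¬¬L = L`. -/
def ObjLit.compl {α : Type w} : ObjLit α → ObjLit α
  | .pos a => .neg a
  | .neg a => .pos a

def ObjLit.map {α : Type u} {γ : Type v} (f : α → γ) : ObjLit α → ObjLit γ
  | .pos a => .pos (f a)
  | .neg a => .neg (f a)

/-- Literals: an objective literal `l`, or a default literal `not l`. -/
inductive Literal (β : Type w)
  | obj (l : β)
  | naf (l : β)

/-- The finite sequence `A` of rules is an argument over the set `G` of ground rules: all its
rules are in `G`, and every objective literal in the body of one of them is the head of a rule
that stands later in the sequence. -/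
def IsArgument {β : Type w} (G : Set (Rule β)) : List (Rule β) → Prop
  | [] => True
  | r :: A => r ∈ G ∧ (∀ l ∈ r.pos, ∃ r' ∈ A, r'.head = l) ∧ IsArgument G A

/-- The conclusions of a sequence of rules. -/
def conc {β : Type w} (A : List (Rule β)) : Set β := {l | ∃ r ∈ A, r.head = l}

/-- The set of all `l` such that `not l` is an assumption of the sequence of rules. -/
def assm {β : Type w} (A : List (Rule β)) : Set β := {l | ∃ r ∈ A, l ∈ r.naf}

/-- `A` is a minimal argument for `l`: no other subsequence of `A` is an argument with
conclusion `l`. -/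
def IsMinimalFor {β : Type w} (G : Set (Rule β)) (A : List (Rule β)) (l : β) : Prop :=
  IsArgument G A ∧ l ∈ conc A ∧
    ∀ A' : List (Rule β), A'.Sublist A → IsArgument G A' → l ∈ conc A' → A' = A

/-- The (minimal) arguments over a set of ground rules. -/
def Args {β : Type w} (G : Set (Rule β)) : Type w :=
  {A : List (Rule β) // ∃ l, IsMinimalFor G A l}

/-! ## Attacks between arguments -/

/-- `A` undercuts `B`. -/
def Undercuts {β : Type w} {G : Set (Rule β)} (A B : Args G) : Prop :=
  ∃ l, l ∈ conc A.1 ∧ l ∈ assm B.1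

/-- `A` rebuts `B`. -/
def Rebuts {α : Type w} {G : Set (Rule (ObjLit α))} (A B : Args G) : Prop :=
  ∃ l, l ∈ conc A.1 ∧ l.compl ∈ conc B.1

/-! ## Acceptability and justified arguments -/

/-- The operator that sends `S` to the set of all `A` such that everything that `x`-attacks `A`
is `y`-attacked by a member of `S`. -/
def acceptable {ι : Type w} (x y : ι → ι → Prop) : Set ι →o Set ι where
  toFun S := {A | ∀ B, x B A → ∃ C ∈ S, y C B}
  monotone' := fun _ _ hST _ hA B hB =>
    let ⟨C, hC, hCB⟩ := hA B hB
    ⟨C, hST hC, hCB⟩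

/-- The least fixpoint of the acceptability operator. -/
def justified {ι : Type w} (x y : ι → ι → Prop) : Set ι := OrderHom.lfp (acceptable x y)

/-- The model given by a set `S` of arguments: all conclusions of members of `S`, and `not l`
whenever every argument for `l` is attacked by a member of `S`. -/
def concSet {β : Type w} {G : Set (Rule β)} (attack : Args G → Args G → Prop)
    (S : Set (Args G)) : Set (Literal β) :=
  Literal.obj '' {l | ∃ A ∈ S, l ∈ conc A.1} ∪
    Literal.naf '' {l | ∀ A : Args G, l ∈ conc A.1 → ∃ B ∈ S, attack B A}

/-! ## The well-founded model of a ground normal program (through unfounded sets)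

A partial interpretation is a pair `(T, F)` of sets of atoms: the true and the false ones. -/

/-- `U` is an unfounded set of `G` with respect to the partial interpretation `I`. -/
def IsUnfounded {β : Type w} (G : Set (Rule β)) (I : Set β × Set β) (U : Set β) : Prop :=
  ∀ r ∈ G, r.head ∈ U →
    (∃ b ∈ r.pos, b ∈ I.2) ∨ (∃ c ∈ r.naf, c ∈ I.1) ∨ (∃ b ∈ r.pos, b ∈ U)

/-- The well-founded operator: the new true atoms are the heads of the rules whose body is
true, the new false atoms are those of the greatest unfounded set. -/
def wfOperator {β : Type w} (G : Set (Rule β)) : (Set β × Set β) →o (Set β × Set β) where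
  toFun I :=
    ({h | ∃ r ∈ G, r.head = h ∧ (∀ b ∈ r.pos, b ∈ I.1) ∧ ∀ c ∈ r.naf, c ∈ I.2},
     ⋃₀ {U | IsUnfounded G I U})
  monotone' := by
    rintro I J ⟨h1, h2⟩
    refine ⟨?_, ?_⟩
    · rintro h ⟨r, hr, hh, hp, hn⟩
      exact ⟨r, hr, hh, fun b hb => h1 (hp b hb), fun c hc => h2 (hn c hc)⟩
    · rintro h ⟨U, hU, hh⟩
      refine ⟨U, fun r hr hrU => ?_, hh⟩
      rcases hU r hr hrU with ⟨b, hb, hb'⟩ | ⟨c, hc, hc'⟩ | hb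
      · exact Or.inl ⟨b, hb, h2 hb'⟩
      · exact Or.inr (Or.inl ⟨c, hc, h1 hc'⟩)
      · exact Or.inr (Or.inr hb)

/-- The well-founded model `T ∪ not F` of a ground normal program. -/
def wfModel {β : Type w} (G : Set (Rule β)) : Set (Literal β) :=
  Literal.obj '' (OrderHom.lfp (wfOperator G)).1 ∪ Literal.naf '' (OrderHom.lfp (wfOperator G)).2

/-! ## The paraconsistent well-founded model of a ground extended program -/

/-- The GL-transformation: remove every rule with a default literal `not l`, `l ∈ I`, and the
default literals of all the other rules. -/
def glTransform {β : Type w} (G : Set (Rule β)) (I : Set β) : Set (Rule β) :=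
  {s | ∃ r ∈ G, (∀ c ∈ r.naf, c ∉ I) ∧ s = ⟨r.head, r.pos, []⟩}

/-- The immediate consequence operator of a definite program (only heads and positive bodies
are looked at). -/
def immediate {β : Type w} (D : Set (Rule β)) : Set β →o Set β where
  toFun I := {h | ∃ r ∈ D, r.head = h ∧ ∀ b ∈ r.pos, b ∈ I}
  monotone' := fun _ _ hIJ _ ⟨r, hr, hh, hb⟩ => ⟨r, hr, hh, fun b hb' => hIJ (hb b hb')⟩

/-- `Γ I`: the least model of the GL-transform, where every objective literal is treated as an
atom of its own. -/
def gam {β : Type w} (G : Set (Rule β)) (I : Set β) : Set β :=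
  OrderHom.lfp (immediate (glTransform G I))

theorem gam_antitone {β : Type w} (G : Set (Rule β)) : Antitone (gam G) := by
  intro I J hIJ
  apply OrderHom.lfp.monotone
  intro S h hh
  obtain ⟨r, ⟨r₀, hr₀, hn, rfl⟩, hh, hb⟩ := hh
  exact ⟨_, ⟨r₀, hr₀, fun c hc hcI => hn c hc (hIJ hcI), rfl⟩, hh, hb⟩

/-- The semi-normal version: every rule `L ← Body` becomes `L ← not ¬L, Body`. -/
def seminormal {α : Type w} (G : Set (Rule (ObjLit α))) : Set (Rule (ObjLit α)) :=
  (fun r => ⟨r.head, r.pos, r.head.compl :: r.naf⟩) '' G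

/-- The operator `Γ Γₛ`. -/
def gamGamS {α : Type w} (G : Set (Rule (ObjLit α))) : Set (ObjLit α) →o Set (ObjLit α) where
  toFun I := gam G (gam (seminormal G) I)
  monotone' := fun _ _ h => gam_antitone G (gam_antitone (seminormal G) h)

/-- `T ∪ not (H − Γₛ T)`, where `T` is the least fixpoint of `Γ Γₛ` and `H` is the set of all
ground objective literals. -/
def wfmP {α : Type w} (G : Set (Rule (ObjLit α))) : Set (Literal (ObjLit α)) :=
  Literal.obj '' (OrderHom.lfp (gamGamS G)) ∪
    Literal.naf '' (gam (seminormal G) (OrderHom.lfp (gamGamS G)))ᶜ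

/-! ## Extended logic programs -/

/-- Atoms `p(t₁, …, tₙ)` over a first-order language, with variables in `V`. -/
structure Atom (L : FirstOrder.Language.{u, v}) (V : Type) where
  arity : ℕ
  rel : L.Relations arity
  args : Fin arity → L.Term V

def Atom.subst {L : FirstOrder.Language.{u, v}} {V W : Type} (s : V → L.Term W)
    (a : Atom L V) : Atom L W :=
  ⟨a.arity, a.rel, fun i => (a.args i).subst s⟩

/-- Ground objective literals: those without variables. -/
abbrev GroundLit (L : FirstOrder.Language.{u, v}) := ObjLit (Atom L Empty)

/-- An extended logic program: a possibly infinite set of rules, with variables in `ℕ`. -/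
abbrev Program (L : FirstOrder.Language.{u, v}) := Set (Rule (ObjLit (Atom L ℕ)))

/-- The variable-free rule `g` is a ground instance of the rule `r`. -/
def IsGroundInstance {L : FirstOrder.Language.{u, v}} (g : Rule (GroundLit L))
    (r : Rule (ObjLit (Atom L ℕ))) : Prop :=
  ∃ s : ℕ → L.Term ℕ,
    r.map (ObjLit.map (Atom.subst s)) = g.map (ObjLit.map (Atom.subst Empty.elim))

/-- All ground instances of the rules of a program. -/
def ground {L : FirstOrder.Language.{u, v}} (P : Program L) : Set (Rule (GroundLit L)) :=
  {g | ∃ r ∈ P, IsGroundInstance g r}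

/-! ## Notions of attack and the semantics `J_{x/y}` -/

/-- A notion of attack assigns to each program a binary relation on its arguments;
`x L P A B` means that `A` `x`-attacks `B`. -/
abbrev NotionOfAttack :=
  ∀ (L : FirstOrder.Language.{u, v}) (P : Program L), Args (ground P) → Args (ground P) → Prop

def undercuts : NotionOfAttack.{u, v} := fun _ _ A B => Undercuts A B

def rebuts : NotionOfAttack.{u, v} := fun _ _ A B => Rebuts A B

def attacks : NotionOfAttack.{u, v} := fun L P A B => undercuts L P A B ∨ rebuts L P A B

def defeats : NotionOfAttack.{u, v} := fun L P A B =>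
  undercuts L P A B ∨ (rebuts L P A B ∧ ¬ undercuts L P B A)

def stronglyAttacks : NotionOfAttack.{u, v} := fun L P A B =>
  attacks L P A B ∧ ¬ undercuts L P B A

def stronglyUndercuts : NotionOfAttack.{u, v} := fun L P A B =>
  undercuts L P A B ∧ ¬ undercuts L P B A

/-- A semantics assigns to each program a set of arguments. Semantics are ordered by inclusion
for all programs, so that `<` means: included for every program, and different for some. -/
abbrev Semantics :=
  ∀ (L : FirstOrder.Language.{u, v}) (P : Program L), Set (Args (ground P))

/-- The set of `x/y`-justified arguments. -/
def J (x y : NotionOfAttack.{u, v}) : Semantics.{u, v} := fun L P => justified (x L P) (y L P)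

/-- The names of the five notions of attack that are compared. -/
inductive AttackName
  | a | u | d | sa | su

/-- The notion of attack with a given name. -/
def AttackName.rel : AttackName → NotionOfAttack.{u, v}
  | .a => attacks
  | .u => undercuts
  | .d => defeats
  | .sa => stronglyAttacks
  | .su => stronglyUndercuts

/-! ## The known semantics -/

/-- Dung's grounded semantics: an argument is accepted if every argument that attacks it, by a
ground attack (undercut) or by a reductio ad absurdum attack (rebut), is ground-attacked by an
accepted argument. -/
def JDung : Semantics.{u, v} := fun _ _ =>
  justified (fun B A => Undercuts B A ∨ Rebuts B A) (fun C B => Undercuts C B)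

/-- Prakken and Sartor's strict defeat: a defeat that is not counter-defeated. -/
def strictlyDefeats : NotionOfAttack.{u, v} := fun L P A B =>
  defeats L P A B ∧ ¬ defeats L P B A

/-- Prakken and Sartor's semantics, without priorities and strict rules: an argument is accepted
if every argument that defeats it is strictly defeated by an accepted argument. -/
def JPS : Semantics.{u, v} := fun L P => justified (defeats L P) (strictlyDefeats L P)

/-- The well-founded argumentation semantics of a ground normal program: the only attacks are
undercuts. -/
def normalJustified {β : Type w} (G : Set (Rule β)) : Set (Args G) :=
  justified (fun B A => Undercuts B A) (fun C B => Undercuts C B)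

/-- The well-founded argumentation semantics of an extended program that is read as a normal
program, the ground objective literals being its atoms (so that `¬A` is unrelated to `A`). -/
def JWFS : Semantics.{u, v} := fun _ P => normalJustified (ground P)

/-- The well-founded model of an extended program that is read in this way. -/
def WFS (L : FirstOrder.Language.{u, v}) (P : Program L) : Set (Literal (GroundLit L)) :=
  wfModel (ground P)

/-- The paraconsistent well-founded model with explicit negation. -/
def WFSXp (L : FirstOrder.Language.{u, v}) (P : Program L) : Set (Literal (GroundLit L)) :=
  wfmP (ground P)

/-! ## The diagram of the hierarchy -/

/-- The ten nodes of the diagram. -/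
inductive Node
  | a_y | d_y | sa_su | u_u | sa_u | su_su | u_a | su_u | su_sa | su_a

/-- The node at which `x/y` stands. -/
def node : AttackName → AttackName → Node
  | .a, _ => .a_y
  | .d, _ => .d_y
  | .u, .su => .u_u
  | .u, .u => .u_u
  | .u, .a => .u_a
  | .u, .d => .u_a
  | .u, .sa => .u_a
  | .sa, .su => .sa_su
  | .sa, .sa => .sa_su
  | .sa, .u => .sa_u
  | .sa, .d => .sa_u
  | .sa, .a => .sa_u
  | .su, .su => .su_su
  | .su, .u => .su_u
  | .su, .sa => .su_sa
  | .su, .a => .su_a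
  | .su, .d => .su_a

/-- The arcs of the diagram, from the lower to the upper node. -/
inductive Arc : Node → Node → Prop
  | a_d : Arc .a_y .d_y
  | d_sasu : Arc .d_y .sa_su
  | d_uu : Arc .d_y .u_u
  | sasu_sau : Arc .sa_su .sa_u
  | sasu_susu : Arc .sa_su .su_su
  | uu_susu : Arc .u_u .su_su
  | uu_ua : Arc .u_u .u_a
  | sau_suu : Arc .sa_u .su_u
  | susu_suu : Arc .su_su .su_u
  | susu_susa : Arc .su_su .su_sa
  | ua_susa : Arc .u_a .su_sa
  | suu_sua : Arc .su_u .su_a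
  | susa_sua : Arc .su_sa .su_a

/-- `m` lies strictly below `n` in the diagram. -/
def Below (m n : Node) : Prop := Relation.TransGen Arc m n

end ELP

end

open ELP

namespace ELP

open Relation

/-! ## Least fixpoints of acceptability -/

section Justified

variable {ι : Type w} {x x' y y' : ι → ι → Prop}

/-! Collapse of classes: the least fixpoint depends only on those defences `y C B` that are not
answered by `x B C`. If a justified `C` is attacked back by `B`, then `C`, being justified, already
has a justified defender against `B` (`justified_eq_of_forall`). Since rebutting is symmetric, this
reduces each `x/y` to one representative defence per class; it also identifies strict defeat with
defeat as a defence against defeat.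

Order: `justified` is antitone in the attack and monotone in the defence, which gives an inclusion
along each arc. The diagram is a distributive lattice, namely the ten down-sets of the five
join-irreducible nodes `d/y`, `sa/su`, `u/u`, `sa/u`, `u/a`. For each of these there is a largest
node not above it, so every non-inclusion reduces to one of five pairs, and five small programs
settle them (`exists_separating`, `exists_not_justified_subset`).

Models: `Γ` and `Γₛ` are computed by arguments. Applied to the conclusions of a set `S` of
arguments, they give the literals with an argument not undercut, respectively not attacked, by `S`;
a further `Γ` gives the conclusions of the arguments acceptable for `S`. Hence the least fixpoints
of `ΓΓ` and `ΓΓₛ` are the conclusions of the `u/u`- and `u/a`-justified arguments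
(`lfp_eq_conclusions`). The definition by unfounded sets joins in through the alternating fixpoint
theorem (`lfp_wfOperator`). -/

theorem mem_justified_iff {A : ι} :
    A ∈ justified x y ↔ ∀ B, x B A → ∃ C ∈ justified x y, y C B := by
  conv_lhs => rw [justified, ← OrderHom.map_lfp]
  rfl

theorem justified_subset {S : Set ι} (h : ∀ A, (∀ B, x B A → ∃ C ∈ S, y C B) → A ∈ S) :
    justified x y ⊆ S :=
  OrderHom.lfp_le _ h

theorem justified_mono (hx : ∀ A B, x' A B → x A B) (hy : ∀ A B, y A B → y' A B) :
    justified x y ⊆ justified x' y' :=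
  justified_subset fun _ h => mem_justified_iff.2 fun B hB =>
    let ⟨C, hC, hCB⟩ := h B (hx _ _ hB)
    ⟨C, hC, hy _ _ hCB⟩

/-- Only defences that are not counter-attacked matter. -/
theorem justified_eq_of_forall (h₁ : ∀ A B, y' A B → y A B)
    (h₂ : ∀ A B, y A B → ¬ x B A → y' A B) : justified x y = justified x y' := by
  refine (justified_subset fun A h => mem_justified_iff.2 fun B hB => ?_).antisymm
    (justified_mono (fun _ _ => id) h₁)
  obtain ⟨C, hC, hCB⟩ := h B hB
  -- If `B` attacks its attacker `C`, the `y'`-defence of `C` against `B` serves for `A` too.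
  by_cases hBC : x B C
  · exact mem_justified_iff.1 hC B hBC
  · exact ⟨C, hC, h₂ _ _ hCB hBC⟩

theorem mem_justified_of_unattacked {A : ι} (h : ∀ B, ¬ x B A) : A ∈ justified x y :=
  mem_justified_iff.2 fun B hB => (h B hB).elim

theorem mem_justified_of_defended {A : ι} (C : ι) (hC : ∀ B, ¬ x B C) (h : ∀ B, x B A → y C B) :
    A ∈ justified x y :=
  mem_justified_iff.2 fun B hB => ⟨C, mem_justified_of_unattacked hC, h B hB⟩

/-- An argument that is its own only possible defender against `B` never enters the least fixpoint:
the complement of `{A}` is closed under acceptability. -/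
theorem notMem_justified {A : ι} (B : ι) (hBA : x B A) (h : ∀ C, y C B → C = A) :
    A ∉ justified x y := by
  have : justified x y ⊆ {A}ᶜ := justified_subset fun C hC hCA => by
    obtain rfl : C = A := hCA
    obtain ⟨D, hD, hDB⟩ := hC B hBA
    exact hD (h D hDB)
  exact fun hA => this hA rfl

end Justified

/-! ## Arguments and least models -/

section Arguments

variable {β : Type w} {G : Set (Rule β)}

theorem IsArgument.append {A B : List (Rule β)} (hA : IsArgument G A) (hB : IsArgument G B) :
    IsArgument G (A ++ B) := by
  induction A with
  | nil => exact hB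
  | cons r A ih =>
    refine ⟨hA.1, fun l hl => ?_, ih hA.2.2⟩
    obtain ⟨r', hr', h⟩ := hA.2.1 l hl
    exact ⟨r', List.mem_append_left _ hr', h⟩

theorem IsArgument.exists_minimal {A : List (Rule β)} {l : β} (hA : IsArgument G A)
    (hl : l ∈ conc A) : ∃ A', A'.Sublist A ∧ IsMinimalFor G A' l := by
  induction hn : A.length using Nat.strong_induction_on generalizing A with
  | _ n ih =>
    by_cases hmin : IsMinimalFor G A l
    · exact ⟨A, List.Sublist.refl _, hmin⟩
    · simp only [IsMinimalFor, not_and, not_forall] at hmin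
      obtain ⟨A', hs, hA', hl', hne⟩ := hmin hA hl
      have hlt : A'.length < n :=
        hn ▸ lt_of_le_of_ne hs.length_le fun h => hne (hs.eq_of_length h)
      obtain ⟨A'', hs', h⟩ := ih _ hlt hA' hl' rfl
      exact ⟨A'', hs'.trans hs, h⟩

theorem Args.isArgument (A : Args G) : IsArgument G A.1 :=
  let ⟨_, h⟩ := A.2
  h.1

/-- The least model of a definite program that consists of the admissible rules of `G`. -/
theorem mem_lfp_immediate_iff {D : Set (Rule β)} {ok : Rule β → Prop}
    (hD : ∀ S h, h ∈ immediate D S ↔ ∃ r ∈ G, ok r ∧ r.head = h ∧ ∀ b ∈ r.pos, b ∈ S) {l : β} :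
    l ∈ OrderHom.lfp (immediate D) ↔ ∃ A : Args G, l ∈ conc A.1 ∧ ∀ r ∈ A.1, ok r := by
  constructor
  · suffices h : OrderHom.lfp (immediate D) ≤
        {l | ∃ A, IsArgument G A ∧ l ∈ conc A ∧ ∀ r ∈ A, ok r} by
      intro hl
      obtain ⟨A, hA, hlA, hok⟩ := h hl
      obtain ⟨A', hs, hmin⟩ := hA.exists_minimal hlA
      exact ⟨⟨A', l, hmin⟩, hmin.2.1, fun r hr => hok r (hs.subset hr)⟩
    refine OrderHom.lfp_le _ fun h hh => ?_
    obtain ⟨r, hr, hok, rfl, hb⟩ := (hD _ _).1 hh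
    -- Arguments for the body literals are concatenated into one; putting the rule in front of it
    -- gives an argument for the head.
    have key : ∀ bs : List β, (∀ b ∈ bs, b ∈ {l | ∃ A, IsArgument G A ∧ l ∈ conc A ∧
        ∀ r ∈ A, ok r}) → ∃ A, IsArgument G A ∧ (∀ b ∈ bs, b ∈ conc A) ∧ ∀ r ∈ A, ok r := by
      intro bs
      induction bs with
      | nil => exact fun _ => ⟨[], trivial, by simp, by simp⟩
      | cons b bs ih =>
        intro h
        obtain ⟨A, hA, hbA, hAok⟩ := h b (by simp)
        obtain ⟨A', hA', hbA', hAok'⟩ := ih fun c hc => h c (by simp [hc])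
        refine ⟨A ++ A', hA.append hA', fun c hc => ?_, fun s hs => ?_⟩
        · rcases List.mem_cons.1 hc with rfl | hc
          · obtain ⟨s, hs, h⟩ := hbA
            exact ⟨s, by simp [hs], h⟩
          · obtain ⟨s, hs, h⟩ := hbA' c hc
            exact ⟨s, by simp [hs], h⟩
        · rcases List.mem_append.1 hs with hs | hs
          exacts [hAok s hs, hAok' s hs]
    obtain ⟨A, hA, hbA, hAok⟩ := key r.pos hb
    exact ⟨r :: A, ⟨hr, hbA, hA⟩, ⟨r, by simp, rfl⟩, by simpa using ⟨hok, hAok⟩⟩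
  · rintro ⟨A, hl, hok⟩
    have key : ∀ A : List (Rule β), IsArgument G A → (∀ r ∈ A, ok r) →
        conc A ⊆ OrderHom.lfp (immediate D) := by
      intro A
      induction A with
      | nil => rintro - - l ⟨r, hr, -⟩; simp at hr
      | cons r A ih =>
        rintro ⟨hr, hpos, hA⟩ hok l ⟨s, hs, rfl⟩
        have ih' := ih hA fun r hr => hok r (by simp [hr])
        rcases List.mem_cons.1 hs with rfl | hs
        · rw [← OrderHom.map_lfp]
          exact (hD _ _).2 ⟨s, hr, hok s (by simp), rfl, fun b hb => ih' (hpos b hb)⟩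
        · exact ih' ⟨s, hs, rfl⟩
    exact key A.1 A.isArgument hok hl

/-! ### `Γ` and `Γₛ` expressed through arguments -/

theorem mem_gam_iff {I : Set β} {l : β} :
    l ∈ gam G I ↔ ∃ A : Args G, l ∈ conc A.1 ∧ ∀ c ∈ assm A.1, c ∉ I := by
  refine (mem_lfp_immediate_iff (G := G) (ok := fun r => ∀ c ∈ r.naf, c ∉ I) fun S h => ?_).trans ?_
  · constructor
    · rintro ⟨_, ⟨r, hr, hc, rfl⟩, hh, hb⟩
      exact ⟨r, hr, hc, hh, hb⟩
    · rintro ⟨r, hr, hc, hh, hb⟩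
      exact ⟨_, ⟨r, hr, hc, rfl⟩, hh, hb⟩
  · exact exists_congr fun A => and_congr_right fun _ =>
      ⟨fun h c ⟨r, hr, hc⟩ => h r hr c hc, fun h r hr c hc => h c ⟨r, hr, hc⟩⟩

theorem head_mem_gam {I : Set β} {r : Rule β} (hr : r ∈ G) (hn : ∀ c ∈ r.naf, c ∉ I)
    (hp : ∀ b ∈ r.pos, b ∈ gam G I) : r.head ∈ gam G I := by
  rw [gam, ← OrderHom.map_lfp]
  exact ⟨_, ⟨r, hr, hn, rfl⟩, rfl, hp⟩

theorem gam_subset {I S : Set β}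
    (h : ∀ r ∈ G, (∀ c ∈ r.naf, c ∉ I) → (∀ b ∈ r.pos, b ∈ S) → r.head ∈ S) : gam G I ⊆ S := by
  refine OrderHom.lfp_le _ ?_
  rintro _ ⟨_, ⟨r, hr, hn, rfl⟩, rfl, hb⟩
  exact h r hr hn hb

/-- The extra literal `not ¬L` of a semi-normal rule becomes a condition on the conclusions, so
arguments over `G` itself suffice; this is what turns undercuts into attacks. -/
theorem mem_gam_seminormal_iff {α : Type w} {G : Set (Rule (ObjLit α))} {I : Set (ObjLit α)}
    {l : ObjLit α} :
    l ∈ gam (seminormal G) I ↔ ∃ A : Args G, l ∈ conc A.1 ∧ (∀ c ∈ assm A.1, c ∉ I) ∧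
      ∀ c ∈ conc A.1, c.compl ∉ I := by
  refine (mem_lfp_immediate_iff (G := G)
    (ok := fun r => r.head.compl ∉ I ∧ ∀ c ∈ r.naf, c ∉ I) fun S h => ?_).trans ?_
  · constructor
    · rintro ⟨_, ⟨_, ⟨r, hr, rfl⟩, hc, rfl⟩, hh, hb⟩
      exact ⟨r, hr, by simpa using hc, hh, hb⟩
    · rintro ⟨r, hr, hc, hh, hb⟩
      exact ⟨_, ⟨_, ⟨r, hr, rfl⟩, by simpa using hc, rfl⟩, hh, hb⟩
  · refine exists_congr fun A => and_congr_right fun _ => ⟨fun h => ⟨?_, ?_⟩, fun h r hr => ⟨?_, ?_⟩⟩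
    · rintro c ⟨r, hr, hc⟩
      exact (h r hr).2 c hc
    · rintro _ ⟨r, hr, rfl⟩
      exact (h r hr).1
    · exact h.2 _ ⟨r, hr, rfl⟩
    · exact fun c hc => h.1 c ⟨r, hr, hc⟩

/-- The conclusions of the members of a set of arguments. -/
def conclusions (S : Set (Args G)) : Set β := {l | ∃ A ∈ S, l ∈ conc A.1}

/-- The literals that have an argument not attacked by `S`. -/
def unattackedConclusions (y : Args G → Args G → Prop) (S : Set (Args G)) : Set β :=
  {l | ∃ A : Args G, l ∈ conc A.1 ∧ ∀ B ∈ S, ¬ y B A}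

theorem concSet_eq (y : Args G → Args G → Prop) (S : Set (Args G)) :
    concSet y S = Literal.obj '' conclusions S ∪ Literal.naf '' (unattackedConclusions y S)ᶜ := by
  have : (unattackedConclusions y S)ᶜ =
      {l | ∀ A : Args G, l ∈ conc A.1 → ∃ B ∈ S, y B A} := by
    ext l
    simp [unattackedConclusions]
  rw [this]
  rfl

theorem gam_conclusions (S : Set (Args G)) :
    gam G (conclusions S) = unattackedConclusions Undercuts S := by
  ext l
  rw [mem_gam_iff]
  refine exists_congr fun A => and_congr_right fun _ => ⟨?_, ?_⟩
  · rintro h B hB ⟨c, hc, hcA⟩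
    exact h c hcA ⟨B, hB, hc⟩
  · rintro h c hcA ⟨B, hB, hc⟩
    exact h B hB ⟨c, hc, hcA⟩

theorem gam_unattackedConclusions (y : Args G → Args G → Prop) (S : Set (Args G)) :
    gam G (unattackedConclusions y S) = conclusions (acceptable Undercuts y S) := by
  ext l
  rw [mem_gam_iff]
  constructor
  · rintro ⟨A, hl, h⟩
    refine ⟨A, fun B => ?_, hl⟩
    rintro ⟨c, hc, hcA⟩
    by_contra hB
    exact h c hcA ⟨B, hc, fun C hC hCB => hB ⟨C, hC, hCB⟩⟩
  · rintro ⟨A, hA, hl⟩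
    refine ⟨A, hl, ?_⟩
    rintro c hcA ⟨B, hc, hB⟩
    obtain ⟨C, hC, hCB⟩ := hA B ⟨c, hc, hcA⟩
    exact hB C hC hCB

/-- Transfer of least fixpoints along `conclusions`. It works because `conclusions` has an upper
adjoint, `X ↦ {A | conc A ⊆ X}`, which pulls the least fixpoint of `Φ` back to a set closed under
acceptability. -/
theorem lfp_eq_conclusions {x y : Args G → Args G → Prop} (Φ : Set β →o Set β)
    (h : ∀ S, Φ (conclusions S) = conclusions (acceptable x y S)) :
    OrderHom.lfp Φ = conclusions (justified x y) := by
  apply le_antisymm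
  · refine OrderHom.lfp_le _ (le_of_eq ?_)
    rw [h, justified, OrderHom.map_lfp]
  · have hS : conclusions {A : Args G | conc A.1 ⊆ OrderHom.lfp Φ} ⊆ OrderHom.lfp Φ := by
      rintro l ⟨A, hA, hl⟩
      exact hA hl
    have : justified x y ⊆ {A : Args G | conc A.1 ⊆ OrderHom.lfp Φ} :=
      justified_subset fun A hA l hl => by
        rw [← OrderHom.map_lfp]
        apply Φ.monotone hS
        rw [h]
        exact ⟨A, hA, hl⟩
    rintro l ⟨A, hA, hl⟩
    exact this hA hl

/-! ## The well-founded model -/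

/-- The operator `Γ Γ`. -/
def gamGam (G : Set (Rule β)) : Set β →o Set β where
  toFun I := gam G (gam G I)
  monotone' := fun _ _ h => gam_antitone G (gam_antitone G h)

/-- Alternating fixpoint theorem: relative to true atoms `T`, the false atoms are those outside `Γ
T`. -/
theorem lfp_wfOperator (G : Set (Rule β)) : OrderHom.lfp (wfOperator G) =
    (OrderHom.lfp (gamGam G), (gam G (OrderHom.lfp (gamGam G)))ᶜ) := by
  apply le_antisymm
  · apply OrderHom.lfp_le
    set T := OrderHom.lfp (gamGam G) with hT
    have hTT : gam G (gam G T) = T := OrderHom.map_lfp (gamGam G)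
    constructor
    · rintro _ ⟨r, hr, rfl, hp, hn⟩
      change r.head ∈ T
      rw [← hTT]
      refine head_mem_gam hr hn ?_
      rwa [hTT]
    · rintro l ⟨U, hU, hl⟩ hlT
      -- Removing an unfounded set from `Γ T` leaves a model of the transformed program, so by
      -- leastness nothing was removed.
      have : gam G T ⊆ Uᶜ ∩ gam G T := gam_subset fun r hr hn hp => by
        refine ⟨fun hrU => ?_, head_mem_gam hr hn fun b hb => (hp b hb).2⟩
        rcases hU r hr hrU with ⟨b, hb, hb'⟩ | ⟨c, hc, hc'⟩ | ⟨b, hb, hb'⟩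
        · exact hb' (hp b hb).2
        · exact hn c hc hc'
        · exact (hp b hb).1 hb'
      exact (this hlT).1 hl
  · obtain ⟨⟨T, F⟩, hI⟩ : ∃ I, OrderHom.lfp (wfOperator G) = I := ⟨_, rfl⟩
    rw [hI]
    have hfix : wfOperator G (T, F) = (T, F) := by rw [← hI, OrderHom.map_lfp]
    -- The complement of `Γ T` is itself unfounded with respect to `(T, F)`.
    have hF : (gam G T)ᶜ ⊆ F := by
      refine Eq.subset (congrArg Prod.snd hfix) |>.trans' ?_
      refine Set.subset_sUnion_of_mem fun r hr hrU => ?_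
      by_contra hcon
      push Not at hcon
      exact hrU (head_mem_gam hr hcon.2.1 fun b hb => by simpa using hcon.2.2 b hb)
    have hT : OrderHom.lfp (gamGam G) ⊆ T := by
      refine OrderHom.lfp_le _ (gam_subset fun r hr hn hp => ?_)
      exact (congrArg Prod.fst hfix).subset ⟨r, hr, rfl, hp, fun c hc => hF (hn c hc)⟩
    exact ⟨hT, (Set.compl_subset_compl.2 (gam_antitone G hT)).trans hF⟩

theorem wfModel_eq_concSet (G : Set (Rule β)) :
    wfModel G = concSet Undercuts (justified Undercuts (Undercuts (G := G))) := by
  have h : OrderHom.lfp (gamGam G) = conclusions (justified Undercuts (Undercuts (G := G))) :=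
    lfp_eq_conclusions _ fun S => by
      change gam G (gam G _) = _
      rw [gam_conclusions, gam_unattackedConclusions]
  rw [wfModel, lfp_wfOperator, concSet_eq, ← gam_conclusions, h]

theorem wfmP_eq_concSet {α : Type w} (G : Set (Rule (ObjLit α))) :
    wfmP G = concSet (fun A B : Args G => Undercuts A B ∨ Rebuts A B)
      (justified Undercuts fun A B => Undercuts A B ∨ Rebuts A B) := by
  have hs : ∀ S : Set (Args G), gam (seminormal G) (conclusions S) =
      unattackedConclusions (fun A B => Undercuts A B ∨ Rebuts A B) S := by
    intro S
    ext l
    rw [mem_gam_seminormal_iff]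
    refine exists_congr fun A => and_congr_right fun _ => ⟨?_, fun h => ⟨?_, ?_⟩⟩
    · rintro ⟨h, h'⟩ B hB (⟨c, hc, hcA⟩ | ⟨c, hc, hcA⟩)
      · exact h c hcA ⟨B, hB, hc⟩
      · refine h' _ hcA ⟨B, hB, ?_⟩
        cases c <;> exact hc
    · rintro c hcA ⟨B, hB, hc⟩
      exact h B hB (.inl ⟨c, hc, hcA⟩)
    · rintro c hcA ⟨B, hB, hc⟩
      refine h B hB (.inr ⟨_, hc, ?_⟩)
      cases c <;> exact hcA
  have h : OrderHom.lfp (gamGamS G) =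
      conclusions (justified Undercuts fun A B : Args G => Undercuts A B ∨ Rebuts A B) :=
    lfp_eq_conclusions _ fun S => by
      change gam G (gam _ _) = _
      rw [hs, gam_unattackedConclusions]
  rw [wfmP, concSet_eq, ← hs, h]

end Arguments

/-! ## Ground programs -/

section Ground

variable {L : FirstOrder.Language.{u, v}}

theorem ObjLit.map_injective {α : Type u} {γ : Type v} {f : α → γ} (hf : Function.Injective f) :
    Function.Injective (ObjLit.map f) := by
  rintro (a | a) (b | b) h <;> simp only [ObjLit.map, ObjLit.pos.injEq, ObjLit.neg.injEq,
    reduceCtorEq] at h <;> rw [hf h]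

theorem Rule.map_injective {β : Type u} {γ : Type v} {f : β → γ} (hf : Function.Injective f) :
    Function.Injective (Rule.map f) := by
  rintro ⟨h, p, n⟩ ⟨h', p', n'⟩ heq
  simp only [Rule.map, Rule.mk.injEq] at heq
  rw [hf heq.1, List.map_injective_iff.2 hf heq.2.1, List.map_injective_iff.2 hf heq.2.2]

theorem Atom.subst_elim_injective :
    Function.Injective (Atom.subst (Empty.elim : Empty → L.Term ℕ)) := by
  have key : ∀ t t' : L.Term Empty, t.subst (Empty.elim : Empty → L.Term ℕ) =
      t'.subst Empty.elim → t = t' := by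
    intro t
    induction t with
    | var e => exact e.elim
    | func f ts ih =>
      rintro (e | ⟨f', ts'⟩) h
      · exact e.elim
      · simp only [FirstOrder.Language.Term.subst, FirstOrder.Language.Term.func.injEq] at h
        obtain ⟨rfl, hf, hts⟩ := h
        obtain rfl := eq_of_heq hf
        congr 1
        exact funext fun i => ih i _ (congrFun (eq_of_heq hts) i)
  rintro ⟨n, R, ts⟩ ⟨n', R', ts'⟩ h
  simp only [Atom.subst, Atom.mk.injEq] at h
  obtain ⟨rfl, hR, hts⟩ := h
  obtain rfl := eq_of_heq hR
  congr 1
  exact funext fun i => key _ _ (congrFun (eq_of_heq hts) i)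

theorem Atom.subst_subst_elim (s : ℕ → L.Term ℕ) (a : Atom L Empty) :
    (a.subst (Empty.elim : Empty → L.Term ℕ)).subst s = a.subst Empty.elim := by
  have key : ∀ t : L.Term Empty, (t.subst (Empty.elim : Empty → L.Term ℕ)).subst s =
      t.subst Empty.elim := by
    intro t
    induction t with
    | var e => exact e.elim
    | func f ts ih => simp [FirstOrder.Language.Term.subst, ih]
  simp [Atom.subst, key]

/-- The variable-free program with given rules. -/
def groundProgram (G : Set (Rule (GroundLit L))) : Program L :=
  Rule.map (ObjLit.map (Atom.subst Empty.elim)) '' G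

/-- Substitutions fix variable-free rules, so any set of ground rules is the grounding of a program,
and counterexamples may be given at ground level. -/
theorem ground_groundProgram (G : Set (Rule (GroundLit L))) : ground (groundProgram G) = G := by
  have hinj : Function.Injective
      (Rule.map (ObjLit.map (Atom.subst (Empty.elim : Empty → L.Term ℕ)))) :=
    Rule.map_injective (ObjLit.map_injective Atom.subst_elim_injective)
  have hs : ∀ (s : ℕ → L.Term ℕ) (g : Rule (GroundLit L)),
      (g.map (ObjLit.map (Atom.subst (Empty.elim : Empty → L.Term ℕ)))).map
        (ObjLit.map (Atom.subst s)) = g.map (ObjLit.map (Atom.subst Empty.elim)) := by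
    intro s g
    have hl : ∀ l : GroundLit L, (l.map (Atom.subst (Empty.elim : Empty → L.Term ℕ))).map
        (Atom.subst s) = l.map (Atom.subst Empty.elim) := by
      rintro (a | a) <;> simp [ObjLit.map, Atom.subst_subst_elim]
    simp [Rule.map, hl]
  ext g
  constructor
  · rintro ⟨_, ⟨g', hg', rfl⟩, s, h⟩
    rw [hs] at h
    exact hinj h ▸ hg'
  · exact fun hg => ⟨_, ⟨g, hg, rfl⟩, FirstOrder.Language.Term.var, hs _ _⟩

end Ground

/-! ## The attack relations over a set of ground rules -/

section Attacks

variable {α : Type w} {G : Set (Rule (ObjLit α))}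

/-- The notion of attack with a given name, on the arguments over a set of ground rules. -/
def AttackName.on (G : Set (Rule (ObjLit α))) : AttackName → Args G → Args G → Prop
  | .a => fun A B => Undercuts A B ∨ Rebuts A B
  | .u => Undercuts
  | .d => fun A B => Undercuts A B ∨ (Rebuts A B ∧ ¬ Undercuts B A)
  | .sa => fun A B => (Undercuts A B ∨ Rebuts A B) ∧ ¬ Undercuts B A
  | .su => fun A B => Undercuts A B ∧ ¬ Undercuts B A

theorem AttackName.rel_eq_on (x : AttackName) (L : FirstOrder.Language.{u, v}) (P : Program L) :
    x.rel L P = x.on (ground P) := by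
  cases x <;> rfl

theorem J_apply (x y : AttackName) (L : FirstOrder.Language.{u, v}) (P : Program L) :
    J x.rel y.rel L P = justified (x.on (ground P)) (y.on (ground P)) := by
  rw [J, x.rel_eq_on, y.rel_eq_on]

theorem Rebuts.symm {A B : Args G} (h : Rebuts A B) : Rebuts B A := by
  obtain ⟨l, hl, hl'⟩ := h
  refine ⟨_, hl', ?_⟩
  cases l <;> exact hl

theorem rebuts_comm {A B : Args G} : Rebuts A B ↔ Rebuts B A :=
  ⟨Rebuts.symm, Rebuts.symm⟩

/-- The least notion of defence that stands with `x/y` at the same node. -/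
def weakestDefence : AttackName → AttackName → AttackName
  | .a, _ => .su
  | .d, _ => .su
  | .u, .su | .u, .u => .su
  | .u, _ => .sa
  | .sa, .su | .sa, .sa => .su
  | .sa, _ => .u
  | .su, .a => .d
  | .su, y => y

theorem justified_weakestDefence (G : Set (Rule (ObjLit α))) (x y : AttackName) :
    justified (x.on G) (y.on G) = justified (x.on G) ((weakestDefence x y).on G) := by
  -- Symmetry of rebuts is the only fact about the relations needed; the rest is propositional.
  apply justified_eq_of_forall <;> intro A B <;>
    cases x <;> cases y <;>
    simp only [AttackName.on, weakestDefence] <;> have := rebuts_comm (A := A) (B := B) <;> tauto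

theorem weakestDefence_eq_of_node_eq {x y x' y' : AttackName} (h : node x y = node x' y') :
    x = x' ∧ weakestDefence x y = weakestDefence x' y' := by
  cases x <;> cases x' <;> cases y <;> cases y' <;> first | exact ⟨rfl, rfl⟩ | nomatch h

theorem justified_eq_of_node_eq {x y x' y' : AttackName} (h : node x y = node x' y') :
    justified (x.on G) (y.on G) = justified (x'.on G) (y'.on G) := by
  obtain ⟨rfl, h⟩ := weakestDefence_eq_of_node_eq h
  rw [justified_weakestDefence, h, ← justified_weakestDefence]

/-- A pair `x/y` that stands at a given node. -/
def Node.pair : Node → AttackName × AttackName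
  | .a_y => (.a, .a)
  | .d_y => (.d, .a)
  | .sa_su => (.sa, .su)
  | .u_u => (.u, .u)
  | .sa_u => (.sa, .u)
  | .su_su => (.su, .su)
  | .u_a => (.u, .a)
  | .su_u => (.su, .u)
  | .su_sa => (.su, .sa)
  | .su_a => (.su, .a)

theorem node_pair (n : Node) : node n.pair.1 n.pair.2 = n := by
  cases n <;> rfl

/-- The arguments that are justified in the semantics at a given node. -/
def Node.justified (n : Node) (G : Set (Rule (ObjLit α))) : Set (Args G) :=
  ELP.justified (n.pair.1.on G) (n.pair.2.on G)

theorem justified_node (x y : AttackName) (G : Set (Rule (ObjLit α))) :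
    (node x y).justified G = justified (x.on G) (y.on G) :=
  justified_eq_of_node_eq (node_pair _)

theorem Arc.justified_subset {m n : Node} (h : Arc m n) (G : Set (Rule (ObjLit α))) :
    m.justified G ⊆ n.justified G := by
  -- Representatives of the two nodes can be chosen so that along each arc either the attack shrinks
  -- or the defence grows, the other one being unchanged.
  have key : ∀ x y x' y' : AttackName, node x y = m → node x' y' = n →
      (∀ A B, x'.on G A B → x.on G A B) → (∀ A B, y.on G A B → y'.on G A B) →
      m.justified G ⊆ n.justified G := by
    rintro x y x' y' rfl rfl hx hy
    rw [justified_node, justified_node]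
    exact justified_mono hx hy
  cases h
  case a_d => exact key .a .a .d .a rfl rfl (by simp only [AttackName.on]; tauto) (fun _ _ => id)
  case d_sasu => exact key .d .su .sa .su rfl rfl (by simp only [AttackName.on]; tauto) (fun _ _ => id)
  case d_uu => exact key .d .u .u .u rfl rfl (by simp only [AttackName.on]; tauto) (fun _ _ => id)
  case sasu_sau => exact key .sa .su .sa .u rfl rfl (fun _ _ => id) (by simp only [AttackName.on]; tauto)
  case sasu_susu =>
    exact key .sa .su .su .su rfl rfl (by simp only [AttackName.on]; tauto) (fun _ _ => id)
  case uu_susu => exact key .u .su .su .su rfl rfl (by simp only [AttackName.on]; tauto) (fun _ _ => id)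
  case uu_ua => exact key .u .u .u .a rfl rfl (fun _ _ => id) (by simp only [AttackName.on]; tauto)
  case sau_suu => exact key .sa .u .su .u rfl rfl (by simp only [AttackName.on]; tauto) (fun _ _ => id)
  case susu_suu => exact key .su .su .su .u rfl rfl (fun _ _ => id) (by simp only [AttackName.on]; tauto)
  case susu_susa =>
    exact key .su .su .su .sa rfl rfl (fun _ _ => id) (by simp only [AttackName.on]; tauto)
  case ua_susa => exact key .u .sa .su .sa rfl rfl (by simp only [AttackName.on]; tauto) (fun _ _ => id)
  case suu_sua => exact key .su .u .su .a rfl rfl (fun _ _ => id) (by simp only [AttackName.on]; tauto)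
  case susa_sua => exact key .su .sa .su .a rfl rfl (fun _ _ => id) (by simp only [AttackName.on]; tauto)

theorem Node.justified_subset {m n : Node} (h : ReflTransGen Arc m n)
    (G : Set (Rule (ObjLit α))) : m.justified G ⊆ n.justified G := by
  induction h with
  | refl => exact subset_rfl
  | tail _ h ih => exact ih.trans (h.justified_subset G)

end Attacks

/-! ## The order of the diagram -/

/-- For each node, the set (in binary) of the nodes among `d/y`, `sa/su`, `u/u`, `sa/u`, `u/a`
that stand at it or below it. -/
def Node.code : Node → ℕ
  | .a_y => 0b00000
  | .d_y => 0b00001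
  | .sa_su => 0b00011
  | .u_u => 0b00101
  | .sa_u => 0b01011
  | .su_su => 0b00111
  | .u_a => 0b10101
  | .su_u => 0b01111
  | .su_sa => 0b10111
  | .su_a => 0b11111

theorem Arc.code_lt {m n : Node} (h : Arc m n) : m.code < n.code := by
  cases h <;> decide

theorem Below.code_lt {m n : Node} (h : Below m n) : m.code < n.code := by
  induction h with
  | single h => exact h.code_lt
  | tail _ h ih => exact ih.trans h.code_lt

theorem reflTransGen_of_code {m n : Node} (h : m.code &&& n.code = m.code) :
    ReflTransGen Arc m n := by
  cases m <;> cases n <;> first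
    | exact ReflTransGen.refl
    | exact absurd h (by decide)
    | solve_by_elim (maxDepth := 14) [ReflTransGen.refl, ReflTransGen.head, Arc.a_d, Arc.d_sasu,
        Arc.d_uu, Arc.sasu_sau, Arc.sasu_susu, Arc.uu_susu, Arc.uu_ua, Arc.sau_suu, Arc.susu_suu,
        Arc.susu_susa, Arc.ua_susa, Arc.suu_sua, Arc.susa_sua]

/-- Each listed pair is a join-irreducible node with the largest node not above it. If `m` is not
below `n`, some bit of the code of `m` is missing from that of `n`, and its pair separates them. -/
theorem exists_separating {m n : Node} (h : ¬ ReflTransGen Arc m n) :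
    ∃ p ∈ [(Node.d_y, Node.a_y), (.sa_su, .u_a), (.u_u, .sa_u), (.sa_u, .su_sa), (.u_a, .su_u)],
      ReflTransGen Arc p.1 m ∧ ReflTransGen Arc n p.2 := by
  have h' : ¬ m.code &&& n.code = m.code := fun h' => h (reflTransGen_of_code h')
  suffices ∃ p ∈ [(Node.d_y, Node.a_y), (.sa_su, .u_a), (.u_u, .sa_u), (.sa_u, .su_sa),
      (.u_a, .su_u)], p.1.code &&& m.code = p.1.code ∧ n.code &&& p.2.code = n.code by
    obtain ⟨p, hp, h₁, h₂⟩ := this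
    exact ⟨p, hp, reflTransGen_of_code h₁, reflTransGen_of_code h₂⟩
  clear h
  cases m <;> cases n <;> revert h' <;> decide

/-! ## Programs without objective literals in the bodies -/

section Separation

variable {α : Type w} {G : Set (Rule (ObjLit α))}

/-- The argument that consists of a single rule with no objective literals in its body. -/
def Args.single (l : ObjLit α) (cs : List (ObjLit α)) (h : ⟨l, [], cs⟩ ∈ G) : Args G :=
  ⟨[⟨l, [], cs⟩], l, by
    refine ⟨⟨h, by simp, trivial⟩, ⟨_, List.mem_singleton_self _, rfl⟩, fun A' hs _ hl => ?_⟩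
    rcases List.sublist_singleton.1 hs with rfl | rfl
    · obtain ⟨r, hr, -⟩ := hl
      simp at hr
    · rfl⟩

/-- A rule without objective body literals is an argument on its own, so minimality leaves only the
rule for the chosen conclusion. -/
theorem Args.exists_eq_single (hG : ∀ r ∈ G, r.pos = []) (A : Args G) :
    ∃ l cs h, A = Args.single l cs h := by
  obtain ⟨A, l, hA, ⟨⟨l', ps, cs⟩, hr, rfl⟩, hmin⟩ := A
  have hrG : ∀ A : List (Rule (ObjLit α)), IsArgument G A → ∀ r ∈ A, r ∈ G := by
    intro A
    induction A with
    | nil => simp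
    | cons r A ih =>
      rintro ⟨hr, -, hA⟩ s hs
      rcases List.mem_cons.1 hs with rfl | hs
      exacts [hr, ih hA s hs]
  have hG' := hrG A hA _ hr
  obtain rfl : ps = [] := hG _ hG'
  refine ⟨l', cs, hG', Subtype.ext (Eq.symm ?_)⟩
  exact hmin _ (List.singleton_sublist.2 hr) ⟨hG', by simp, trivial⟩
    ⟨_, List.mem_singleton_self _, rfl⟩

@[simp]
theorem undercuts_single {l l' : ObjLit α} {cs cs' : List (ObjLit α)} {h : ⟨l, [], cs⟩ ∈ G}
    {h' : ⟨l', [], cs'⟩ ∈ G} : Undercuts (Args.single l cs h) (Args.single l' cs' h') ↔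
      l ∈ cs' := by
  simp [Undercuts, Args.single, conc, assm]

@[simp]
theorem rebuts_single {l l' : ObjLit α} {cs cs' : List (ObjLit α)} {h : ⟨l, [], cs⟩ ∈ G}
    {h' : ⟨l', [], cs'⟩ ∈ G} : Rebuts (Args.single l cs h) (Args.single l' cs' h') ↔
      l' = l.compl := by
  simp [Rebuts, Args.single, conc, eq_comm]

/-! ### The five separating programs -/

/-- `p`; `¬p ← not p`. -/
theorem exists_d_not_a (p : α) : ∃ G : Set (Rule (ObjLit α)),
    ¬ Node.d_y.justified G ⊆ Node.a_y.justified G := by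
  let G : Set (Rule (ObjLit α)) := {⟨.pos p, [], []⟩, ⟨.neg p, [], [.pos p]⟩}
  have hG : ∀ r ∈ G, r.pos = [] := by simp [G]
  refine ⟨G, Set.not_subset.2 ⟨.single (.pos p) [] (by simp [G]), ?_, ?_⟩⟩
  -- The rebut of `p` by `¬p` is no defeat, since `p` undercuts back.
  · refine mem_justified_of_unattacked fun B => ?_
    obtain ⟨l, cs, h, rfl⟩ := B.exists_eq_single hG
    have h' := h
    simp only [G, Set.mem_insert_iff, Set.mem_singleton_iff, Rule.mk.injEq, true_and] at h'
    rcases h' with ⟨rfl, rfl⟩ | ⟨rfl, rfl⟩ <;> simp [Node.pair, AttackName.on, ObjLit.compl]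
  · refine notMem_justified (.single (.neg p) [.pos p] (by simp [G])) ?_ fun C => ?_
    · simp [Node.pair, AttackName.on, ObjLit.compl]
    obtain ⟨l, cs, h, rfl⟩ := C.exists_eq_single hG
    have h' := h
    simp only [G, Set.mem_insert_iff, Set.mem_singleton_iff, Rule.mk.injEq, true_and] at h'
    rcases h' with ⟨rfl, rfl⟩ | ⟨rfl, rfl⟩ <;> simp [Node.pair, AttackName.on, ObjLit.compl]

/-- `p ← not q`; `q ← not p`. -/
theorem exists_sa_su_not_u_a {p q : α} (hpq : p ≠ q) : ∃ G : Set (Rule (ObjLit α)),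
    ¬ Node.sa_su.justified G ⊆ Node.u_a.justified G := by
  let G : Set (Rule (ObjLit α)) := {⟨.pos p, [], [.pos q]⟩, ⟨.pos q, [], [.pos p]⟩}
  have hG : ∀ r ∈ G, r.pos = [] := by simp [G]
  refine ⟨G, Set.not_subset.2 ⟨.single (.pos p) [.pos q] (by simp [G]), ?_, ?_⟩⟩
  -- The two arguments undercut each other, so no attack is strong.
  · refine mem_justified_of_unattacked fun B => ?_
    obtain ⟨l, cs, h, rfl⟩ := B.exists_eq_single hG
    have h' := h
    simp only [G, Set.mem_insert_iff, Set.mem_singleton_iff, Rule.mk.injEq, true_and] at h'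
    rcases h' with ⟨rfl, rfl⟩ | ⟨rfl, rfl⟩ <;>
      simp [Node.pair, AttackName.on, ObjLit.compl, hpq]
  · refine notMem_justified (.single (.pos q) [.pos p] (by simp [G])) ?_ fun C => ?_
    · simp [Node.pair, AttackName.on]
    obtain ⟨l, cs, h, rfl⟩ := C.exists_eq_single hG
    have h' := h
    simp only [G, Set.mem_insert_iff, Set.mem_singleton_iff, Rule.mk.injEq, true_and] at h'
    rcases h' with ⟨rfl, rfl⟩ | ⟨rfl, rfl⟩ <;>
      simp [Node.pair, AttackName.on, ObjLit.compl, hpq.symm]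

/-- `p`; `¬p`. -/
theorem exists_u_u_not_sa_u (p : α) : ∃ G : Set (Rule (ObjLit α)),
    ¬ Node.u_u.justified G ⊆ Node.sa_u.justified G := by
  let G : Set (Rule (ObjLit α)) := {⟨.pos p, [], []⟩, ⟨.neg p, [], []⟩}
  have hG : ∀ r ∈ G, r.pos = [] := by simp [G]
  refine ⟨G, Set.not_subset.2 ⟨.single (.pos p) [] (by simp [G]), ?_, ?_⟩⟩
  · refine mem_justified_of_unattacked fun B => ?_
    obtain ⟨l, cs, h, rfl⟩ := B.exists_eq_single hG
    simp [Node.pair, AttackName.on]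
  -- Without default literals there are no undercuts: the rebut is strong and cannot be answered.
  · refine notMem_justified (.single (.neg p) [] (by simp [G])) ?_ fun C => ?_
    · simp [Node.pair, AttackName.on, ObjLit.compl]
    obtain ⟨l, cs, h, rfl⟩ := C.exists_eq_single hG
    simp [Node.pair, AttackName.on]

/-- `p ← not q`; `q ← not r`; `r ← not q`. -/
theorem exists_sa_u_not_su_sa {p q r : α} (hpq : p ≠ q) (hpr : p ≠ r) (hqr : q ≠ r) :
    ∃ G : Set (Rule (ObjLit α)), ¬ Node.sa_u.justified G ⊆ Node.su_sa.justified G := by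
  let G : Set (Rule (ObjLit α)) :=
    {⟨.pos p, [], [.pos q]⟩, ⟨.pos q, [], [.pos r]⟩, ⟨.pos r, [], [.pos q]⟩}
  have hG : ∀ r ∈ G, r.pos = [] := by simp [G]
  refine ⟨G, Set.not_subset.2 ⟨.single (.pos p) [.pos q] (by simp [G]), ?_, ?_⟩⟩
  -- `r` undercuts `q` and faces no strong attack; but as `q` undercuts `r` back, `r` does not
  -- strongly attack `q`, so the defence fails for `su/sa`.
  · refine mem_justified_of_defended (.single (.pos r) [.pos q] (by simp [G])) (fun B => ?_)
      fun B => ?_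
    all_goals
      obtain ⟨l, cs, h, rfl⟩ := B.exists_eq_single hG
      have h' := h
      simp only [G, Set.mem_insert_iff, Set.mem_singleton_iff, Rule.mk.injEq, true_and] at h'
      rcases h' with ⟨rfl, rfl⟩ | ⟨rfl, rfl⟩ | ⟨rfl, rfl⟩ <;>
        simp [Node.pair, AttackName.on, ObjLit.compl, hpq, hqr.symm]
  · refine notMem_justified (.single (.pos q) [.pos r] (by simp [G])) ?_ fun C => ?_
    · simp [Node.pair, AttackName.on, hpr]
    obtain ⟨l, cs, h, rfl⟩ := C.exists_eq_single hG
    have h' := h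
    simp only [G, Set.mem_insert_iff, Set.mem_singleton_iff, Rule.mk.injEq, true_and] at h'
    rcases h' with ⟨rfl, rfl⟩ | ⟨rfl, rfl⟩ | ⟨rfl, rfl⟩ <;>
      simp [Node.pair, AttackName.on, ObjLit.compl, hpr, hqr]

/-- `p ← not q`; `q`; `¬q`. -/
def rebuttedUndercutter (p q : α) : Set (Rule (ObjLit α)) :=
  {⟨.pos p, [], [.pos q]⟩, ⟨.pos q, [], []⟩, ⟨.neg q, [], []⟩}

theorem pos_eq_nil_of_mem_rebuttedUndercutter {p q : α} {r : Rule (ObjLit α)}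
    (h : r ∈ rebuttedUndercutter p q) : r.pos = [] := by
  rcases h with rfl | rfl | rfl <;> rfl

theorem pos_not_mem_rebuttedUndercutter {p q : α} :
    ⟨.pos p, [], [.pos q]⟩ ∈ rebuttedUndercutter p q :=
  .inl rfl

theorem pos_mem_rebuttedUndercutter {p q : α} : ⟨.pos q, [], []⟩ ∈ rebuttedUndercutter p q :=
  .inr (.inl rfl)

theorem neg_mem_rebuttedUndercutter {p q : α} : ⟨.neg q, [], []⟩ ∈ rebuttedUndercutter p q :=
  .inr (.inr rfl)

/-- The rebut of `q` by `¬q` defends `p`, and nothing undercuts `¬q`. For `su/u` this defence is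
lost, as `q` is never undercut. -/
theorem single_mem_u_a {p q : α} :
    Args.single (.pos p) [.pos q] pos_not_mem_rebuttedUndercutter ∈ Node.u_a.justified (rebuttedUndercutter p q) := by
  refine mem_justified_of_defended (.single (.neg q) [] neg_mem_rebuttedUndercutter)
    (fun B => ?_) fun B => ?_
  all_goals
    obtain ⟨l, cs, h, rfl⟩ := B.exists_eq_single fun _ => pos_eq_nil_of_mem_rebuttedUndercutter
    simp +contextual [Node.pair, AttackName.on, ObjLit.compl]

theorem single_notMem_su_u {p q : α} :
    Args.single (.pos p) [.pos q] pos_not_mem_rebuttedUndercutter ∉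
      Node.su_u.justified (rebuttedUndercutter p q) := by
  refine notMem_justified (.single (.pos q) [] pos_mem_rebuttedUndercutter) ?_ fun C => ?_
  · simp [Node.pair, AttackName.on]
  obtain ⟨l, cs, h, rfl⟩ := C.exists_eq_single fun _ => pos_eq_nil_of_mem_rebuttedUndercutter
  simp [Node.pair, AttackName.on]

theorem exists_not_justified_subset {p q r : α} (hpq : p ≠ q) (hpr : p ≠ r) (hqr : q ≠ r)
    {m n : Node} (h : ¬ ReflTransGen Arc m n) :
    ∃ G : Set (Rule (ObjLit α)), ¬ m.justified G ⊆ n.justified G := by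
  obtain ⟨⟨m', n'⟩, hp, hm, hn⟩ := exists_separating h
  suffices ∃ G : Set (Rule (ObjLit α)), ¬ m'.justified G ⊆ n'.justified G by
    obtain ⟨G, hG⟩ := this
    exact ⟨G, fun h => hG (((Node.justified_subset hm G).trans h).trans
      (Node.justified_subset hn G))⟩
  simp only [List.mem_cons, Prod.mk.injEq, List.not_mem_nil, or_false] at hp
  rcases hp with ⟨rfl, rfl⟩ | ⟨rfl, rfl⟩ | ⟨rfl, rfl⟩ | ⟨rfl, rfl⟩ | ⟨rfl, rfl⟩
  · exact exists_d_not_a p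
  · exact exists_sa_su_not_u_a hpq
  · exact exists_u_u_not_sa_u p
  · exact exists_sa_u_not_su_sa hpq hpr hqr
  · exact ⟨rebuttedUndercutter p q, fun h => single_notMem_su_u (h single_mem_u_a)⟩

end Separation

/-! ## The hierarchy of semantics -/

/-- A language with infinitely many propositional atoms. -/
def propLanguage : FirstOrder.Language.{u, v} := ⟨fun _ => PEmpty, fun _ => ULift ℕ⟩

def propAtom (k : ℕ) : Atom propLanguage.{u, v} Empty := ⟨0, ⟨k⟩, Fin.elim0⟩

theorem propAtom_ne {j k : ℕ} (h : j ≠ k) : propAtom.{u, v} j ≠ propAtom k := by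
  intro h'
  exact h (congrArg (fun a => ULift.down.{v} (α := ℕ) a.rel) h')

theorem J_apply_eq_node (x y : AttackName) (L : FirstOrder.Language.{u, v}) (P : Program L) :
    J x.rel y.rel L P = (node x y).justified (ground P) := by
  rw [J_apply, justified_node]

theorem J_le_iff {x y x' y' : AttackName} : J.{u, v} x.rel y.rel ≤ J.{u, v} x'.rel y'.rel ↔
    ReflTransGen Arc (node x y) (node x' y') := by
  constructor
  · intro h
    by_contra hn
    obtain ⟨G, hG⟩ := exists_not_justified_subset
      (propAtom_ne.{u, v} (j := 0) (k := 1) (by decide))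
      (propAtom_ne.{u, v} (j := 0) (k := 2) (by decide)) (propAtom_ne (by decide)) hn
    have hle : (node x y).justified (ground (groundProgram G)) ⊆
        (node x' y').justified (ground (groundProgram G)) := by
      rw [← J_apply_eq_node, ← J_apply_eq_node]
      exact h _ _
    rw [ground_groundProgram] at hle
    exact hG hle
  · intro h L P
    rw [J_apply_eq_node, J_apply_eq_node]
    exact Node.justified_subset h _

theorem J_lt_iff {x y x' y' : AttackName} : J.{u, v} x.rel y.rel < J.{u, v} x'.rel y'.rel ↔
    Below (node x y) (node x' y') := by
  rw [lt_iff_le_not_ge, J_le_iff, J_le_iff]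
  constructor
  · rintro ⟨h, h'⟩
    rcases reflTransGen_iff_eq_or_transGen.1 h with h | h
    · exact (h' (h ▸ .refl)).elim
    · exact h
  · refine fun h => ⟨h.to_reflTransGen, fun h' => ?_⟩
    -- Codes increase strictly along arcs, so the diagram has no cycle.
    exact lt_irrefl _ (Below.code_lt (TransGen.trans_left h h'))

theorem J_eq_iff {x y x' y' : AttackName} : J.{u, v} x.rel y.rel = J.{u, v} x'.rel y'.rel ↔
    node x y = node x' y' := by
  constructor
  · intro h
    rcases reflTransGen_iff_eq_or_transGen.1 (J_le_iff.1 h.le) with h' | h'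
    · exact h'.symm
    · exact ((J_lt_iff.2 h').ne h).elim
  · intro h
    funext L P
    rw [J_apply_eq_node, J_apply_eq_node, h]

/-! ### Known semantics and models -/

theorem JPS_eq : JPS.{u, v} = J.{u, v} defeats defeats := by
  funext L P
  exact (justified_eq_of_forall (fun _ _ h => h.1) fun _ _ h h' => ⟨h, h'⟩).symm

theorem WFS_eq_concSet (L : FirstOrder.Language.{u, v}) (P : Program L) :
    WFS L P = concSet (undercuts L P) (J undercuts undercuts L P) :=
  wfModel_eq_concSet (ground P)

theorem WFSXp_eq_concSet (L : FirstOrder.Language.{u, v}) (P : Program L) :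
    WFSXp L P = concSet (attacks L P) (J undercuts attacks L P) :=
  wfmP_eq_concSet (ground P)

theorem WFS_le_WFSXp : WFS.{u, v} ≤ WFSXp.{u, v} := by
  intro L P
  rw [WFS_eq_concSet, WFSXp_eq_concSet]
  have hJ : J undercuts undercuts L P ⊆ J undercuts attacks L P :=
    justified_mono (fun _ _ => id) fun _ _ => .inl
  refine Set.union_subset_union (Set.image_mono ?_) (Set.image_mono ?_)
  · rintro l ⟨A, hA, hl⟩
    exact ⟨A, hJ hA, hl⟩
  · intro l h A hA
    obtain ⟨B, hB, hBA⟩ := h A hA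
    exact ⟨B, hJ hB, .inl hBA⟩

theorem wfModel_ne_wfmP {α : Type w} {p q : α} (hpq : p ≠ q) :
    wfModel (rebuttedUndercutter p q) ≠ wfmP (rebuttedUndercutter p q) := by
  rw [wfModel_eq_concSet, wfmP_eq_concSet]
  intro h
  have hp : Literal.obj (ObjLit.pos p) ∈ concSet Undercuts
      (justified Undercuts (Undercuts (G := rebuttedUndercutter p q))) := by
    rw [h]
    exact .inl ⟨_, ⟨_, single_mem_u_a, _, List.mem_singleton_self _, rfl⟩, rfl⟩
  rcases hp with ⟨_, ⟨A, hA, hl⟩, hl'⟩ | ⟨_, -, hl'⟩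
  · obtain rfl := Literal.obj.inj hl'
    obtain ⟨l, cs, hr, rfl⟩ := A.exists_eq_single fun _ => pos_eq_nil_of_mem_rebuttedUndercutter
    obtain ⟨r, hr', hl⟩ := hl
    obtain rfl := List.mem_singleton.1 hr'
    obtain rfl : l = .pos p := hl
    have hcs := hr
    simp only [rebuttedUndercutter, Set.mem_insert_iff, Set.mem_singleton_iff, Rule.mk.injEq,
      ObjLit.pos.injEq, hpq, reduceCtorEq, true_and, false_and, or_false] at hcs
    subst hcs
    -- A `u/u`-justified argument for `p` would be `su/u`-justified, which the same program
    -- excludes.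
    refine single_notMem_su_u (Node.justified_subset (m := .u_u) ?_ _ hA)
    exact (ReflTransGen.single Arc.uu_susu).tail Arc.susu_suu
  · cases hl'

theorem WFS_lt_WFSXp : WFS.{u, v} < WFSXp.{u, v} := by
  refine lt_of_le_of_ne WFS_le_WFSXp fun h => ?_
  have hne := wfModel_ne_wfmP (propAtom_ne.{u, v} (j := 0) (k := 1) (by decide))
  rw [← ground_groundProgram (rebuttedUndercutter _ _)] at hne
  exact hne (congrFun (congrFun h propLanguage) (groundProgram _))

end ELP

theorem mainTheorem11 :
    -- two pairs `x/y` stand at the same node of the diagram iff they give the same semantics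
    (∀ x y x' y' : AttackName,
      J.{u, v} x.rel y.rel = J.{u, v} x'.rel y'.rel ↔ node x y = node x' y') ∧
    -- one stands below the other iff its semantics is properly included
    (∀ x y x' y' : AttackName,
      J.{u, v} x.rel y.rel < J.{u, v} x'.rel y'.rel ↔ Below (node x y) (node x' y')) ∧
    -- the places of the known semantics
    (∀ y : AttackName, JDung.{u, v} = J.{u, v} attacks y.rel) ∧
    (∀ y : AttackName, JPS.{u, v} = J.{u, v} defeats y.rel) ∧
    (JWFS.{u, v} = J.{u, v} undercuts undercuts ∧
      JWFS.{u, v} = J.{u, v} undercuts stronglyUndercuts) ∧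
    (∀ (L : FirstOrder.Language.{u, v}) (P : Program L),
      WFS L P = concSet (undercuts L P) (J undercuts undercuts L P)) ∧
    (∀ y : AttackName, y = .a ∨ y = .d ∨ y = .sa →
      ∀ (L : FirstOrder.Language.{u, v}) (P : Program L),
        WFSXp L P = concSet (attacks L P) (J undercuts y.rel L P)) ∧
    -- the chain
    JDung.{u, v} < JPS.{u, v} ∧ JPS.{u, v} < JWFS.{u, v} ∧
    JWFS.{u, v} < J.{u, v} undercuts attacks ∧
    WFS.{u, v} < WFSXp.{u, v} := by
  have hDung : JDung.{u, v} = J.{u, v} attacks undercuts := rfl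
  have hWFS : JWFS.{u, v} = J.{u, v} undercuts undercuts := rfl
  have hJ : ∀ x y x' y' : AttackName, node x y = node x' y' →
      J.{u, v} x.rel y.rel = J.{u, v} x'.rel y'.rel := fun _ _ _ _ => J_eq_iff.2
  refine ⟨fun _ _ _ _ => J_eq_iff, fun _ _ _ _ => J_lt_iff, fun y => hJ .a .u .a y rfl,
    fun y => JPS_eq.trans (hJ .d .d .d y rfl), ⟨hWFS, hJ .u .u .u .su rfl⟩, WFS_eq_concSet, ?_,
    ?_, ?_, ?_, WFS_lt_WFSXp⟩
  · intro y hy L P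
    have h : J.{u, v} undercuts attacks = J.{u, v} undercuts y.rel :=
      hJ .u .a .u y (by rcases hy with rfl | rfl | rfl <;> rfl)
    rw [WFSXp_eq_concSet, h]
  · rw [hDung, JPS_eq]
    exact J_lt_iff (x := .a) (y := .u) (x' := .d) (y' := .d) |>.2 (.single .a_d)
  · rw [hWFS, JPS_eq]
    exact J_lt_iff (x := .d) (y := .d) (x' := .u) (y' := .u) |>.2 (.single .d_uu)
  · rw [hWFS]
    exact J_lt_iff (x := .u) (y := .u) (x' := .u) (y' := .a) |>.2 (.single .uu_ua)
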